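/- For integers $N\ge 0$ let $[N]=1+q+\cdots+q^{N-1}$, and for integers $N,K$ let ${N\brack K}=\prod_{i=1}^{K}\frac{1-q^{N-i+1}}{1-q^{i}}$ if $K\ge 0$ and ${N\brack K}=0$ if $K<0$. For Laurent polynomials $A,B$ and a polynomial $D$ in $q$ with integer coefficients, write $A\equiv B \pmod D$ if $A-B$ is $D$ times a Laurent polynomial in $q$ with integer coefficients. Let $a,b,c,n\ge 1$ and $j,r\ge 0$ be integers with $j\le a+b+c$, and let either $\varepsilon_k=q^{j(k^2+k)-(2r+1)k}$ for all $k\ge0$, or $\varepsilon_k=(-1)^kq^{\binom k2+j(k^2+k)-2rk}$ for all $k\ge0$. Put $$S=\sum_{k=0}^n\varepsilon_k[2k+1]^{2r+1}{6n+1\brack 3n-k}^a{4n+1\brack 2n-k}^b{2n+1\brack n-k}^c.$$ Then $S\equiv 0\pmod{[2n+1]{6n+1\brack n}}$ and $S\equiv 0\pmod{[2n+1]{6n+1\brack 3n}}$, where the sum $S$ is a Laurent polynomial and both moduli are polynomials in $q$, all with integer coefficients. -/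

import Mathlib

open scoped LaurentPolynomial

noncomputable section

namespace QCong

/-- The field of rational functions in `q`, as the fraction field of the ring of Laurent polynomials
in `q` with integer coefficients. -/
abbrev QField : Type := FractionRing ℤ[T;T⁻¹]

/-- The indeterminate `q`. -/
def q : QField := algebraMap ℤ[T;T⁻¹] QField (LaurentPolynomial.T 1)

/-- The `q`-integer `[n] = 1 + q + ⋯ + q ^ (n - 1)`. -/
def qInt (n : ℕ) : QField := ∑ i ∈ Finset.range n, q ^ i

/-- The `q`-binomial coefficient: the product of `(1 - q ^ (n - i + 1)) / (1 - q ^ i)` over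
`1 ≤ i ≤ k` if `k ≥ 0`, and `0` otherwise. -/
def qBinom (n k : ℤ) : QField :=
  if 0 ≤ k then ∏ i ∈ Finset.Icc (1 : ℤ) k, (1 - q ^ (n - i + 1)) / (1 - q ^ i) else 0

/-- `A ≡ B mod D`: the modulus `D` is a polynomial in `q`, `A` and `B` are Laurent polynomials
in `q`, and `A - B` is `D` times a Laurent polynomial (all with integer coefficients). -/
def LaurentModEq (D A B : QField) : Prop :=
  ∃ (d : Polynomial ℤ) (f g : ℤ[T;T⁻¹]),
    algebraMap ℤ[T;T⁻¹] QField (Polynomial.toLaurent d) = D ∧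
    algebraMap ℤ[T;T⁻¹] QField f = A ∧
    algebraMap ℤ[T;T⁻¹] QField g = B ∧
    Polynomial.toLaurent d ∣ f - g

/-- The weights `q ^ (j (k² + k) - (2r + 1) k)`. -/
def epsPlain (j r k : ℕ) : QField :=
  q ^ ((j : ℤ) * ((k : ℤ) ^ 2 + k) - (2 * (r : ℤ) + 1) * k)

/-- The weights `(-1) ^ k q ^ (k.choose 2 + j (k² + k) - 2rk)`. -/
def epsAlt (j r k : ℕ) : QField :=
  (-1) ^ k * q ^ ((k.choose 2 : ℤ) + (j : ℤ) * ((k : ℤ) ^ 2 + k) - 2 * (r : ℤ) * k)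

/-- The sum over `0 ≤ k ≤ n` of
`ε_k [2k+1]^(2r+1) [6n+1, 3n-k]^a [4n+1, 2n-k]^b [2n+1, n-k]^c`, where `[N, K]` stands for the
`q`-binomial coefficient. -/
def tripleSum (ε : ℕ → QField) (n a b c r : ℕ) : QField :=
  ∑ k ∈ Finset.range (n + 1), ε k * qInt (2 * k + 1) ^ (2 * r + 1) *
    qBinom (6 * n + 1) (3 * n - k) ^ a *
    qBinom (4 * n + 1) (2 * n - k) ^ b *
    qBinom (2 * n + 1) (n - k) ^ c

end QCong

end

noncomputable section

namespace QCong

/-! ### The variable `q` and the `q`-integers -/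

/-! Write K(n,k) = 1/([n-k]! [n+k+1]!), so that the q-binomial (2n+1 over n-k) is [2n+1]! K(n,k).
The sum S then becomes explicit q-factorials times a weighted sum of products of kernels K(3n,k),
K(2n,k), K(n,k).

The core claim is `ChainIntegral`: for a sequence n_1, ..., n_m, the sum over k of f(k) ∏ K(n_i,k)
becomes a Laurent polynomial once multiplied by [n_1]! ∏ [n_i+n_{i+1}+1]! [n_m]!. The proof is a
Bailey-type induction on the length. A q-Chu-Vandermonde identity expands K(n,k)K(m,k) in single
kernels K(s,k), and the coefficients combine with the factorials into Gaussian polynomials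
(`ChainIntegral.transform_cons`). The two forms of Vandermonde allow each merge to absorb a factor
q^(k²+k) or not; a limiting form absorbs one more at a single kernel. Hence j may be as large as the
number of kernels (`ChainIntegral.q_pow_mul`).

For one kernel, the weights with r = 0 telescope (`chainIntegral_plain`, `chainIntegral_alt`), and a
three-term relation raises r (`ChainIntegral.sqWeight_mul`).

The order of the sequence affects the normalising factor but not the product of kernels: the orders
(n, 3n, 2n) and (3n, n, 2n) give the two moduli. -/

lemma q_pow_eq (n : ℕ) : q ^ n = algebraMap ℤ[T;T⁻¹] QField (LaurentPolynomial.T n) := by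
  rw [q, ← map_pow, LaurentPolynomial.T_pow]
  simp

lemma q_ne_zero : q ≠ 0 := by
  intro h
  have h1 := (IsFractionRing.injective ℤ[T;T⁻¹] QField) (h.trans (map_zero _).symm)
  exact (LaurentPolynomial.isUnit_T 1).ne_zero h1

lemma q_pow_ne_one {n : ℕ} (hn : n ≠ 0) : q ^ n ≠ 1 := by
  intro h
  rw [q_pow_eq, ← map_one (algebraMap ℤ[T;T⁻¹] QField)] at h
  have h1 := (IsFractionRing.injective ℤ[T;T⁻¹] QField) h
  rw [← Polynomial.toLaurent_X_pow, ← map_one Polynomial.toLaurent] at h1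
  have h2 := congrArg Polynomial.natDegree (Polynomial.toLaurent_injective h1)
  simp only [Polynomial.natDegree_X_pow, Polynomial.natDegree_one] at h2
  exact hn h2

lemma one_sub_q_ne_zero : 1 - q ≠ 0 := by
  have := q_pow_ne_one one_ne_zero
  rw [pow_one] at this
  exact sub_ne_zero.mpr this.symm

lemma qInt_eq (n : ℕ) : qInt n = (1 - q ^ n) / (1 - q) := by
  rw [eq_div_iff one_sub_q_ne_zero, qInt, mul_comm, mul_neg_geom_sum]

lemma qInt_ne_zero {n : ℕ} (hn : n ≠ 0) : qInt n ≠ 0 := by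
  rw [qInt_eq]
  exact div_ne_zero (sub_ne_zero.mpr (q_pow_ne_one hn).symm) one_sub_q_ne_zero

lemma qInt_one : qInt 1 = 1 := by simp [qInt]

lemma qInt_add (m n : ℕ) : qInt (m + n) = qInt m + q ^ m * qInt n := by
  simp only [qInt_eq, pow_add]
  field_simp [one_sub_q_ne_zero]
  ring

/-! ### Laurent polynomials and polynomials inside the field of rational functions -/

/-- The Laurent polynomials with integer coefficients, as a subring of `QField`. -/
def laurentSubring : Subring QField := (algebraMap ℤ[T;T⁻¹] QField).range

/-- The polynomials with integer coefficients, as a subring of `QField`. -/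
def polySubring : Subring QField :=
  ((algebraMap ℤ[T;T⁻¹] QField).comp (Polynomial.toLaurent (R := ℤ))).range

lemma poly_le_laurent : polySubring ≤ laurentSubring := by
  rintro _ ⟨p, rfl⟩
  exact ⟨_, rfl⟩

lemma q_mem_poly : q ∈ polySubring := ⟨Polynomial.X, by simp [q]⟩

lemma q_zpow_mem (z : ℤ) : q ^ z ∈ laurentSubring := by
  refine ⟨LaurentPolynomial.T z, ?_⟩
  obtain ⟨n, rfl | rfl⟩ := z.eq_nat_or_neg
  · rw [zpow_natCast, q_pow_eq]
  · rw [zpow_neg, zpow_natCast, q_pow_eq]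
    refine eq_inv_of_mul_eq_one_left ?_
    rw [← map_mul, ← LaurentPolynomial.T_add]
    simp

lemma qInt_mem_poly (n : ℕ) : qInt n ∈ polySubring :=
  sum_mem fun _ _ => pow_mem q_mem_poly _

lemma qInt_mem (n : ℕ) : qInt n ∈ laurentSubring := poly_le_laurent (qInt_mem_poly n)

lemma one_sub_q_mem : 1 - q ∈ laurentSubring :=
  sub_mem (one_mem _) (poly_le_laurent q_mem_poly)

/-! ### `q`-factorials and Gaussian binomial coefficients -/

/-- The `q`-factorial `[n]! = [1][2]⋯[n]`. -/
def qFac (n : ℕ) : QField := ∏ i ∈ Finset.range n, qInt (i + 1)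

lemma qFac_zero : qFac 0 = 1 := by simp [qFac]

lemma qFac_succ (n : ℕ) : qFac (n + 1) = qFac n * qInt (n + 1) := by
  simp [qFac, Finset.prod_range_succ]

lemma qFac_ne_zero (n : ℕ) : qFac n ≠ 0 :=
  Finset.prod_ne_zero_iff.mpr fun _ _ => qInt_ne_zero (Nat.succ_ne_zero _)

lemma qFac_mem (n : ℕ) : qFac n ∈ laurentSubring := prod_mem fun _ _ => qInt_mem _

/-- The Gaussian binomial coefficients, by Pascal's rule. -/
def gauss : ℕ → ℕ → QField
  | _, 0 => 1
  | 0, _ + 1 => 0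
  | n + 1, k + 1 => gauss n k + q ^ (k + 1) * gauss n (k + 1)

lemma gauss_zero_right (n : ℕ) : gauss n 0 = 1 := by cases n <;> rfl

lemma gauss_succ_succ (n k : ℕ) :
    gauss (n + 1) (k + 1) = gauss n k + q ^ (k + 1) * gauss n (k + 1) := rfl

lemma gauss_eq_zero {n k : ℕ} (h : n < k) : gauss n k = 0 := by
  induction n generalizing k with
  | zero =>
    obtain ⟨k, rfl⟩ := Nat.exists_eq_succ_of_ne_zero (by lia : k ≠ 0)
    rfl
  | succ n ih =>
    obtain ⟨k, rfl⟩ := Nat.exists_eq_succ_of_ne_zero (by lia : k ≠ 0)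
    rw [Nat.succ_eq_add_one, gauss_succ_succ, ih (by lia), ih (by lia)]
    simp

lemma gauss_mem_poly (n k : ℕ) : gauss n k ∈ polySubring := by
  induction n generalizing k with
  | zero => cases k with
    | zero => exact one_mem _
    | succ k => exact zero_mem _
  | succ n ih => cases k with
    | zero => exact one_mem _
    | succ k => exact add_mem (ih k) (mul_mem (pow_mem q_mem_poly _) (ih _))

lemma gauss_mem (n k : ℕ) : gauss n k ∈ laurentSubring := poly_le_laurent (gauss_mem_poly n k)

lemma gauss_mul (m k : ℕ) : gauss (m + k) k * (qFac k * qFac m) = qFac (m + k) := by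
  obtain ⟨n, hn⟩ : ∃ n, n = m + k := ⟨_, rfl⟩
  induction n generalizing m k with
  | zero =>
    obtain ⟨rfl, rfl⟩ : m = 0 ∧ k = 0 := by lia
    simp [gauss_zero_right, qFac_zero]
  | succ n ih =>
    cases k with
    | zero => simp [gauss_zero_right, qFac_zero]
    | succ k =>
      cases m with
      | zero =>
        have h := ih 0 k (by lia)
        simp only [zero_add] at h ⊢
        rw [qFac_zero, mul_one, mul_eq_right₀ (qFac_ne_zero k)] at h
        rw [gauss_succ_succ, gauss_eq_zero (Nat.lt_succ_self k), h, qFac_zero]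
        ring
      | succ m =>
        have h1 := ih (m + 1) k (by lia)
        have h2 := ih m (k + 1) (by lia)
        rw [show m + 1 + k = m + k + 1 by ring] at h1
        rw [← add_assoc] at h2
        rw [show m + 1 + (k + 1) = (m + k + 1) + 1 by ring, gauss_succ_succ,
          qFac_succ (m + k + 1), show m + k + 1 + 1 = (k + 1) + (m + 1) by ring, qInt_add]
        rw [qFac_succ m] at h1 ⊢
        rw [qFac_succ k] at h2 ⊢
        linear_combination qInt (k + 1) * h1 + q ^ (k + 1) * qInt (m + 1) * h2

lemma gauss_add (m k : ℕ) : gauss (m + k) k = qFac (m + k) / (qFac k * qFac m) := by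
  rw [eq_div_iff (mul_ne_zero (qFac_ne_zero _) (qFac_ne_zero _)), gauss_mul]

lemma gauss_eq {n k : ℕ} (h : k ≤ n) : gauss n k = qFac n / (qFac k * qFac (n - k)) := by
  obtain ⟨m, rfl⟩ := Nat.exists_eq_add_of_le' h
  rw [gauss_add, Nat.add_sub_cancel]

/-- The second form of Pascal's rule. -/
lemma gauss_succ_succ' (n k : ℕ) :
    gauss (n + 1) (k + 1) = q ^ ((n : ℤ) - k) * gauss n k + gauss n (k + 1) := by
  rcases lt_trichotomy n k with h | rfl | h
  · simp [gauss_eq_zero h, gauss_eq_zero (h.trans (Nat.lt_succ_self k)),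
      gauss_eq_zero (Nat.succ_lt_succ h)]
  · rw [gauss_succ_succ, gauss_eq_zero (Nat.lt_succ_self n)]
    simp
  · obtain ⟨m, rfl⟩ := Nat.exists_eq_add_of_lt h
    have h1 := gauss_add (m + 1) k
    have h2 := gauss_add m (k + 1)
    have h3 := gauss_add (m + 1) (k + 1)
    rw [show m + 1 + k = k + m + 1 by ring] at h1
    rw [show m + (k + 1) = k + m + 1 by ring] at h2
    rw [show m + 1 + (k + 1) = k + m + 1 + 1 by ring] at h3
    rw [h1, h2, h3, qFac_succ (k + m + 1), show k + m + 1 + 1 = (m + 1) + (k + 1) by ring,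
      qInt_add, qFac_succ k, qFac_succ m,
      show ((k + m + 1 : ℕ) : ℤ) - k = ((m + 1 : ℕ) : ℤ) by push_cast; ring, zpow_natCast]
    have := qFac_ne_zero k
    have := qFac_ne_zero m
    have := qInt_ne_zero (Nat.succ_ne_zero k)
    have := qInt_ne_zero (Nat.succ_ne_zero m)
    field_simp
    ring

lemma qBinom_natCast {n k : ℕ} (h : k ≤ n) : qBinom n k = gauss n k := by
  rw [gauss_eq h, eq_div_iff (mul_ne_zero (qFac_ne_zero _) (qFac_ne_zero _))]
  induction k with
  | zero => simp [qBinom, qFac_zero]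
  | succ k ih =>
    have hk := ih (by lia)
    obtain ⟨m, rfl⟩ := Nat.exists_eq_add_of_lt (show k < n by lia)
    rw [← hk, show k + m + 1 - k = m + 1 by lia, show k + m + 1 - (k + 1) = m by lia]
    have hI : Finset.Icc (1 : ℤ) ((k + 1 : ℕ) : ℤ) =
        insert ((k + 1 : ℕ) : ℤ) (Finset.Icc (1 : ℤ) k) := by
      ext x
      simp only [Finset.mem_Icc, Finset.mem_insert]
      push_cast
      lia
    rw [qBinom, qBinom, if_pos (by positivity), if_pos (by positivity), hI,
      Finset.prod_insert (by simp), qFac_succ, qFac_succ, qInt_eq, qInt_eq,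
      show ((k + m + 1 : ℕ) : ℤ) - ((k + 1 : ℕ) : ℤ) + 1 = ((m + 1 : ℕ) : ℤ) by push_cast; ring,
      zpow_natCast, zpow_natCast]
    have h1 : 1 - q ^ (k + 1) ≠ 0 := sub_ne_zero.mpr (q_pow_ne_one (Nat.succ_ne_zero k)).symm
    have h2 := one_sub_q_ne_zero
    field_simp

/-! ### The `q`-Chu-Vandermonde identities -/

/-- Induction on `a`: Pascal's rule splits the sum into the instances `c + 1` and `c` for `a`, which
Pascal's rule recombines on the right. -/
lemma vandermonde_square (a N c : ℕ) :
    ∑ t ∈ Finset.range (a + 1), q ^ (t * (t + c)) * gauss a t * gauss N (t + c) =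
      gauss (a + N) (a + c) := by
  induction a generalizing c with
  | zero => simp [gauss_zero_right]
  | succ a ih =>
    have h1 : ∀ t ∈ Finset.range (a + 1),
        q ^ ((t + 1) * (t + 1 + c)) * gauss (a + 1) (t + 1) * gauss N (t + 1 + c) =
        q ^ (a + c + 1) * (q ^ (t * (t + (c + 1))) * gauss a t * gauss N (t + (c + 1))) +
        q ^ ((t + 1) * (t + 1 + c)) * gauss a (t + 1) * gauss N (t + 1 + c) := by
      intro t ht
      obtain ⟨d, rfl⟩ := Nat.exists_eq_add_of_le (Nat.lt_succ_iff.mp (Finset.mem_range.mp ht))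
      rw [gauss_succ_succ', show ((t + d : ℕ) : ℤ) - t = (d : ℤ) by push_cast; ring, zpow_natCast,
        show t + 1 + c = t + (c + 1) by ring]
      ring
    rw [Finset.sum_range_succ', Finset.sum_congr rfl h1, Finset.sum_add_distrib,
      ← Finset.mul_sum, ih, add_assoc]
    -- The instance `c` is padded with the vanishing term t = a + 1, then its term t = 0 is split
    -- off to match the shifted sum.
    have h2 := Finset.sum_range_succ'
      (fun t => q ^ (t * (t + c)) * gauss a t * gauss N (t + c)) (a + 1)
    rw [Finset.sum_range_succ, gauss_eq_zero (Nat.lt_succ_self a), ih] at h2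
    simp only [gauss_zero_right] at h2 ⊢
    rw [← h2, show a + 1 + N = a + N + 1 by ring, show a + 1 + c = a + c + 1 by ring,
      gauss_succ_succ, ← add_assoc a c 1]
    ring

/-- The same induction with the two forms of Pascal's rule exchanged. The integer exponent is
negative only if t + c > N, where the second Gaussian coefficient vanishes. -/
lemma vandermonde_rectangle (a N c : ℕ) :
    ∑ t ∈ Finset.range (a + 1),
        q ^ (((a : ℤ) - t) * ((N : ℤ) - c - t)) * gauss a t * gauss N (t + c) =
      gauss (a + N) (a + c) := by
  induction a generalizing c with
  | zero => simp [gauss_zero_right]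
  | succ a ih =>
    have hq := q_ne_zero
    have h1 : ∀ t ∈ Finset.range (a + 1),
        q ^ ((((a + 1 : ℕ) : ℤ) - (t + 1 : ℕ)) * ((N : ℤ) - c - (t + 1 : ℕ))) *
          gauss (a + 1) (t + 1) * gauss N (t + 1 + c) =
        q ^ (((a : ℤ) - t) * ((N : ℤ) - (c + 1 : ℕ) - t)) * gauss a t * gauss N (t + (c + 1)) +
        q ^ ((N : ℤ) - c) * (q ^ (((a : ℤ) - (t + 1 : ℕ)) * ((N : ℤ) - c - (t + 1 : ℕ))) *
          gauss a (t + 1) * gauss N (t + 1 + c)) := by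
      intro t ht
      rw [gauss_succ_succ, show t + 1 + c = t + (c + 1) by ring, ← zpow_natCast q (t + 1), mul_add,
        add_mul]
      congr 1
      · congr 3
        push_cast
        ring
      · rw [← mul_assoc, ← mul_assoc, ← mul_assoc, ← zpow_add₀ hq, ← zpow_add₀ hq]
        congr 3
        push_cast
        ring
    rw [Finset.sum_range_succ', Finset.sum_congr rfl h1, Finset.sum_add_distrib,
      ← Finset.mul_sum, ih, add_assoc]
    have h2 := Finset.sum_range_succ'
      (fun t : ℕ => q ^ (((a : ℤ) - t) * ((N : ℤ) - c - t)) * gauss a t * gauss N (t + c)) (a + 1)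
    rw [Finset.sum_range_succ, gauss_eq_zero (Nat.lt_succ_self a), ih] at h2
    simp only [gauss_zero_right] at h2 ⊢
    have h3 : q ^ ((((a + 1 : ℕ) : ℤ) - (0 : ℕ)) * ((N : ℤ) - c - (0 : ℕ))) =
        q ^ ((N : ℤ) - c) * q ^ (((a : ℤ) - (0 : ℕ)) * ((N : ℤ) - c - (0 : ℕ))) := by
      rw [← zpow_add₀ hq]
      congr 1
      push_cast
      ring
    rw [show a + 1 + N = a + N + 1 by ring, show a + 1 + c = a + c + 1 by ring,
      gauss_succ_succ', show ((a + N : ℕ) : ℤ) - (a + c : ℕ) = (N : ℤ) - c by push_cast; ring, h3,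
      ← add_assoc a c 1]
    linear_combination -q ^ ((N : ℤ) - c) * h2

/-- The limit N → ∞ of `vandermonde_square`, proved directly by the same recursion; the powers of 1
- q convert q-factorials to products of 1 - q^i. -/
lemma sum_qFac_ratio (a c : ℕ) :
    ∑ t ∈ Finset.range (a + 1),
        q ^ (t * (t + c)) * gauss a t * ((1 - q) ^ (a - t) * (qFac (a + c) / qFac (t + c))) =
      1 := by
  induction a generalizing c with
  | zero => simp [gauss_zero_right, qFac_ne_zero]
  | succ a ih =>
    have h0 : (1 - q) * qInt (a + c + 1) = 1 - q ^ (a + c + 1) := by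
      rw [qInt_eq]
      field_simp [one_sub_q_ne_zero]
    have h1 : ∀ t ∈ Finset.range (a + 1),
        q ^ ((t + 1) * (t + 1 + c)) * gauss (a + 1) (t + 1) *
          ((1 - q) ^ (a + 1 - (t + 1)) * (qFac (a + 1 + c) / qFac (t + 1 + c))) =
        q ^ (a + c + 1) * (q ^ (t * (t + (c + 1))) * gauss a t *
          ((1 - q) ^ (a - t) * (qFac (a + (c + 1)) / qFac (t + (c + 1))))) +
        q ^ ((t + 1) * (t + 1 + c)) * gauss a (t + 1) *
          ((1 - q) ^ (a + 1 - (t + 1)) * (qFac (a + 1 + c) / qFac (t + 1 + c))) := by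
      intro t ht
      obtain ⟨d, rfl⟩ := Nat.exists_eq_add_of_le (Nat.lt_succ_iff.mp (Finset.mem_range.mp ht))
      rw [gauss_succ_succ', show ((t + d : ℕ) : ℤ) - t = (d : ℤ) by push_cast; ring, zpow_natCast,
        show t + 1 + c = t + (c + 1) by ring, show t + d + 1 + c = t + d + (c + 1) by ring,
        Nat.add_sub_add_right]
      ring
    rw [Finset.sum_range_succ', Finset.sum_congr rfl h1, Finset.sum_add_distrib,
      ← Finset.mul_sum, ih, add_assoc]
    have h2 := Finset.sum_range_succ'
      (fun t => q ^ (t * (t + c)) * gauss a t *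
        ((1 - q) ^ (a + 1 - t) * (qFac (a + 1 + c) / qFac (t + c)))) (a + 1)
    rw [Finset.sum_range_succ, gauss_eq_zero (Nat.lt_succ_self a)] at h2
    have h3 : ∑ t ∈ Finset.range (a + 1), q ^ (t * (t + c)) * gauss a t *
        ((1 - q) ^ (a + 1 - t) * (qFac (a + 1 + c) / qFac (t + c))) = 1 - q ^ (a + c + 1) := by
      rw [← h0, ← mul_one (_ * qInt _)]
      refine Eq.trans ?_ (congrArg (fun x => (1 - q) * qInt (a + c + 1) * x) (ih c))
      rw [Finset.mul_sum]
      refine Finset.sum_congr rfl fun t ht => ?_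
      rw [Nat.sub_add_comm (Nat.lt_succ_iff.mp (Finset.mem_range.mp ht)),
        show a + 1 + c = a + c + 1 by ring, qFac_succ]
      ring
    rw [h3] at h2
    simp only [gauss_zero_right] at h2 ⊢
    rw [← h2]
    ring

/-! ### The kernel of the Bailey transform -/

/-- The kernel `1 / ([n - k]! [n + k + 1]!)`, which is `0` for `k > n`. -/
def kernel (n k : ℕ) : QField := if k ≤ n then (qFac (n - k) * qFac (n + k + 1))⁻¹ else 0

/-- The reciprocal `1 / [n - s]!`, which is `0` for `s > n`. -/
def invFacSub (n s : ℕ) : QField := if s ≤ n then (qFac (n - s))⁻¹ else 0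

lemma kernel_of_lt {n k : ℕ} (h : n < k) : kernel n k = 0 := if_neg (by lia)

lemma kernel_add (k a : ℕ) : kernel (k + a) k = (qFac a * qFac (a + (2 * k + 1)))⁻¹ := by
  rw [kernel, if_pos (by lia), show k + a - k = a by lia,
    show k + a + k + 1 = a + (2 * k + 1) by ring]

lemma invFacSub_of_lt {n s : ℕ} (h : n < s) : invFacSub n s = 0 := if_neg (by lia)

lemma qFac_mul_invFacSub {n s : ℕ} (h : s ≤ n) :
    qFac n * invFacSub n s = gauss n s * qFac s := by
  have := qFac_ne_zero s
  have := qFac_ne_zero (n - s)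
  rw [invFacSub, if_pos h, gauss_eq h]
  field_simp

lemma gauss_eq_invFacSub (b t c : ℕ) :
    gauss (b + c) (t + c) = qFac (b + c) * ((qFac (t + c))⁻¹ * invFacSub b t) := by
  by_cases h : t ≤ b
  · rw [invFacSub, if_pos h, gauss_eq (by lia), show b + c - (t + c) = b - t by lia,
      div_eq_mul_inv, mul_inv]
  · rw [invFacSub_of_lt (by lia), gauss_eq_zero (by lia)]
    ring

lemma sum_mul_kernel (w : ℕ → QField) (k a : ℕ) :
    ∑ s ∈ Finset.range (k + a + 1), w s * kernel s k =
      ∑ t ∈ Finset.range (a + 1), w (k + t) * (qFac t * qFac (t + (2 * k + 1)))⁻¹ := by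
  rw [add_assoc k a 1, Finset.sum_range_add, Finset.sum_eq_zero, zero_add]
  · exact Finset.sum_congr rfl fun t _ => by rw [kernel_add]
  · intro s hs
    rw [kernel_of_lt (Finset.mem_range.mp hs), mul_zero]

lemma sum_mul_kernel_of_lt (w : ℕ → QField) {n k : ℕ} (h : n < k) :
    ∑ s ∈ Finset.range (n + 1), w s * kernel s k = 0 := by
  refine Finset.sum_eq_zero fun s hs => ?_
  rw [kernel_of_lt (by have := Finset.mem_range.mp hs; lia), mul_zero]

lemma invFacSub_add_add (k b t : ℕ) : invFacSub (k + b) (k + t) = invFacSub b t := by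
  simp [invFacSub, Nat.add_sub_add_left]

/-- A product of two kernels is a combination of kernels, given a `q`-Chu-Vandermonde identity. -/
lemma kernel_mul_kernel_of_vandermonde (v u : ℕ → QField) (n m k : ℕ)
    (h : ∀ a b, n = k + a → m = k + b →
      ∑ t ∈ Finset.range (a + 1), u (k + t) * (gauss a t * gauss (b + (2 * k + 1))
        (t + (2 * k + 1))) = v k * gauss (a + (b + (2 * k + 1))) (a + (2 * k + 1))) :
    qFac (n + m + 1) * (v k * (kernel n k * kernel m k)) =
      ∑ s ∈ Finset.range (n + 1), u s * (invFacSub n s * invFacSub m s) * kernel s k := by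
  rcases lt_or_ge n k with hn | hn
  · rw [sum_mul_kernel_of_lt _ hn, kernel_of_lt hn]
    ring
  rcases lt_or_ge m k with hm | hm
  · rw [kernel_of_lt hm, Finset.sum_eq_zero]
    · ring
    · intro s _
      rcases lt_or_ge s k with hs | hs
      · rw [kernel_of_lt hs, mul_zero]
      · rw [invFacSub_of_lt (show m < s by lia)]
        ring
  obtain ⟨a, rfl⟩ := Nat.exists_eq_add_of_le hn
  obtain ⟨b, rfl⟩ := Nat.exists_eq_add_of_le hm
  have h1 := h a b rfl rfl
  -- With n = k + a, m = k + b, s = k + t, the kernels become Gaussian coefficients with shift 2k +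
  -- 1, and `h` applies.
  set c := 2 * k + 1 with hc
  have ha := qFac_ne_zero a
  have hb := qFac_ne_zero b
  have hac := qFac_ne_zero (a + c)
  have hbc := qFac_ne_zero (b + c)
  have h2 : ∑ s ∈ Finset.range (k + a + 1),
      u s * (invFacSub (k + a) s * invFacSub (k + b) s) * kernel s k =
      (qFac a * qFac (b + c))⁻¹ * ∑ t ∈ Finset.range (a + 1), u (k + t) *
        (gauss a t * gauss (b + c) (t + c)) := by
    rw [sum_mul_kernel, Finset.mul_sum]
    refine Finset.sum_congr rfl fun t ht => ?_
    have hta : t ≤ a := Nat.lt_succ_iff.mp (Finset.mem_range.mp ht)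
    have h3 := gauss_eq_invFacSub a t 0
    simp only [add_zero] at h3
    rw [invFacSub_add_add, invFacSub_add_add, gauss_eq_invFacSub, h3, ← hc]
    field_simp
  rw [h2, h1, kernel_add, kernel_add, ← hc, show k + a + (k + b) + 1 = b + (a + c) by lia,
    show a + (b + c) = b + (a + c) by ring, gauss_add b (a + c)]
  field_simp

lemma kernel_mul_kernel (n m k : ℕ) :
    qFac (n + m + 1) * (1 * (kernel n k * kernel m k)) =
      ∑ s ∈ Finset.range (n + 1), q ^ (((n : ℤ) - s) * ((m : ℤ) - s)) *
        (invFacSub n s * invFacSub m s) * kernel s k := by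
  refine kernel_mul_kernel_of_vandermonde (fun _ => 1)
    (fun s => q ^ (((n : ℤ) - s) * ((m : ℤ) - s))) n m k ?_
  rintro a b rfl rfl
  rw [one_mul, ← vandermonde_rectangle]
  refine Finset.sum_congr rfl fun t _ => ?_
  rw [mul_assoc]
  congr 2
  push_cast
  ring

lemma q_pow_mul_kernel_mul_kernel (n m k : ℕ) :
    qFac (n + m + 1) * (q ^ (k * k + k) * (kernel n k * kernel m k)) =
      ∑ s ∈ Finset.range (n + 1), q ^ (s * s + s) *
        (invFacSub n s * invFacSub m s) * kernel s k := by
  refine kernel_mul_kernel_of_vandermonde (fun k => q ^ (k * k + k))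
    (fun s => q ^ (s * s + s)) n m k ?_
  rintro a b rfl rfl
  rw [← vandermonde_square, Finset.mul_sum]
  refine Finset.sum_congr rfl fun t _ => ?_
  ring

/-- The limit m → ∞ of `q_pow_mul_kernel_mul_kernel`: it absorbs a power of q with no second kernel
present. -/
lemma q_pow_mul_kernel (n k : ℕ) :
    q ^ (k * k + k) * kernel n k =
      ∑ s ∈ Finset.range (n + 1), q ^ (s * s + s) * ((1 - q) ^ (n - s) * invFacSub n s) *
        kernel s k := by
  rcases lt_or_ge n k with hn | hn
  · rw [sum_mul_kernel_of_lt _ hn, kernel_of_lt hn, mul_zero]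
  obtain ⟨a, rfl⟩ := Nat.exists_eq_add_of_le hn
  rw [sum_mul_kernel, kernel_add, ← mul_one (_ * _)]
  refine (congrArg (fun x => q ^ (k * k + k) * (qFac a * qFac (a + (2 * k + 1)))⁻¹ * x)
    (sum_qFac_ratio a (2 * k + 1)).symm).trans ?_
  rw [Finset.mul_sum]
  refine Finset.sum_congr rfl fun t ht => ?_
  have ha := qFac_ne_zero a
  have hac := qFac_ne_zero (a + (2 * k + 1))
  have h3 := gauss_eq_invFacSub a t 0
  simp only [add_zero] at h3
  rw [invFacSub_add_add, h3, Nat.add_sub_add_left,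
    show (k + t) * (k + t) + (k + t) = k * k + k + t * (t + (2 * k + 1)) by ring,
    pow_add q (k * k + k)]
  field_simp

/-! ### Sums of products of kernels along a list -/

/-- The product `∏ [nᵢ + nᵢ₊₁ + 1]!` along the list `n :: L`, times `[m]!` for its last entry `m`. -/
def chainFac : ℕ → List ℕ → QField
  | n, [] => qFac n
  | n, m :: L => qFac (n + m + 1) * chainFac m L

/-- The sum of `f k` times the product of the kernels at `k` of the entries of `n :: L`. -/
def chainSum (f : ℕ → QField) (n : ℕ) (L : List ℕ) : QField :=
  ∑ k ∈ Finset.range (n + 1), f k * (kernel n k * (L.map fun m => kernel m k).prod)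

/-- The normalised sums of products of kernels along `n :: L` are Laurent polynomials for
all `n`. -/
def ChainIntegral (f : ℕ → QField) (L : List ℕ) : Prop :=
  ∀ n, qFac n * chainFac n L * chainSum f n L ∈ laurentSubring

/-- Only the first factorial of the chain involves `n`; dividing it by [n-s]! leaves a Gaussian
polynomial times the same factorial for `s`. -/
lemma chainFac_mul_invFacSub {n s : ℕ} (h : s ≤ n) (L : List ℕ) :
    ∃ x ∈ laurentSubring, chainFac n L * invFacSub n s = x * chainFac s L := by
  cases L with
  | nil => exact ⟨_, gauss_mem n s, qFac_mul_invFacSub h⟩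
  | cons m L =>
    refine ⟨_, gauss_mem (n + (m + 1)) (s + (m + 1)), ?_⟩
    have := qFac_ne_zero (s + (m + 1))
    rw [chainFac, chainFac, gauss_eq_invFacSub, add_assoc, add_assoc]
    field_simp

lemma chainSum_extend (f : ℕ → QField) {n s : ℕ} (h : s ≤ n) (L : List ℕ) :
    chainSum f s L =
      ∑ k ∈ Finset.range (n + 1), f k * (kernel s k * (L.map fun m => kernel m k).prod) := by
  refine Finset.sum_subset (Finset.range_mono (by lia)) fun k _ hk => ?_
  rw [kernel_of_lt (by simpa using hk)]
  ring

lemma chainSum_transform (f v w x : ℕ → QField) (n : ℕ) (L : List ℕ)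
    (h : ∀ k, v k * x k = ∑ s ∈ Finset.range (n + 1), w s * kernel s k) :
    ∑ k ∈ Finset.range (n + 1), v k * f k * (x k * (L.map fun m => kernel m k).prod) =
      ∑ s ∈ Finset.range (n + 1), w s * chainSum f s L := by
  have h1 : ∀ s ∈ Finset.range (n + 1), w s * chainSum f s L = ∑ k ∈ Finset.range (n + 1),
      w s * (f k * (kernel s k * (L.map fun m => kernel m k).prod)) := fun s hs => by
    rw [chainSum_extend f (Nat.lt_succ_iff.mp (Finset.mem_range.mp hs)), Finset.mul_sum]
  rw [Finset.sum_congr rfl h1, Finset.sum_comm]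
  refine Finset.sum_congr rfl fun k _ => ?_
  calc _ = f k * (L.map fun m => kernel m k).prod * (v k * x k) := by ring
    _ = _ := by
      rw [h, Finset.mul_sum]
      exact Finset.sum_congr rfl fun s _ => by ring

/-- The factor [n+m+1]! is spent on the expansion. Then [n]!/[n-s]! yields [s]!, and the rest of the
chain over [m-s]! yields the chain started at `s`, so the claim for `L` at `s` finishes. -/
lemma ChainIntegral.transform_cons {f : ℕ → QField} {L : List ℕ} (hf : ChainIntegral f L)
    (m : ℕ) (v : ℕ → QField) (u : ℕ → ℕ → QField) (hu : ∀ n s, u n s ∈ laurentSubring)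
    (h : ∀ n k, qFac (n + m + 1) * (v k * (kernel n k * kernel m k)) =
      ∑ s ∈ Finset.range (n + 1), u n s * (invFacSub n s * invFacSub m s) * kernel s k) :
    ChainIntegral (fun k => v k * f k) (m :: L) := by
  intro n
  have h1 := chainSum_transform f v (fun s => u n s * (invFacSub n s * invFacSub m s))
    (fun k => qFac (n + m + 1) * (kernel n k * kernel m k)) n L
    (fun k => by rw [← h n k]; ring)
  have h2 : qFac n * chainFac n (m :: L) * chainSum (fun k => v k * f k) n (m :: L) =
      ∑ s ∈ Finset.range (n + 1), u n s * (qFac n * invFacSub n s) *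
        (chainFac m L * invFacSub m s) * chainSum f s L := by
    calc _ = qFac n * chainFac m L * ∑ k ∈ Finset.range (n + 1),
          v k * f k * (qFac (n + m + 1) * (kernel n k * kernel m k) *
            (L.map fun m => kernel m k).prod) := by
          rw [chainFac, chainSum, Finset.mul_sum, Finset.mul_sum]
          refine Finset.sum_congr rfl fun k _ => ?_
          rw [List.map_cons, List.prod_cons]
          ring
      _ = _ := by
          rw [h1, Finset.mul_sum]
          exact Finset.sum_congr rfl fun s _ => by ring
  rw [h2]
  refine sum_mem fun s hs => ?_
  have hsn : s ≤ n := Nat.lt_succ_iff.mp (Finset.mem_range.mp hs)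
  rcases lt_or_ge m s with hsm | hsm
  · rw [invFacSub_of_lt hsm, mul_zero, mul_zero, zero_mul]
    exact zero_mem _
  obtain ⟨x, hx, hxe⟩ := chainFac_mul_invFacSub hsm L
  rw [hxe, qFac_mul_invFacSub hsn, show u n s * (gauss n s * qFac s) * (x * chainFac s L) *
    chainSum f s L = u n s * gauss n s * x * (qFac s * chainFac s L * chainSum f s L) by ring]
  exact mul_mem (mul_mem (mul_mem (hu n s) (gauss_mem n s)) hx) (hf s)

lemma ChainIntegral.cons {f : ℕ → QField} {L : List ℕ} (hf : ChainIntegral f L) (m : ℕ) :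
    ChainIntegral f (m :: L) := by
  simpa only [one_mul] using hf.transform_cons m (fun _ => 1)
    (fun n s => q ^ (((n : ℤ) - s) * ((m : ℤ) - s))) (fun _ _ => q_zpow_mem _)
    (fun n k => kernel_mul_kernel n m k)

lemma ChainIntegral.cons_q_pow {f : ℕ → QField} {L : List ℕ} (hf : ChainIntegral f L) (m : ℕ) :
    ChainIntegral (fun k => q ^ (k * k + k) * f k) (m :: L) :=
  hf.transform_cons m _ (fun _ s => q ^ (s * s + s))
    (fun _ _ => poly_le_laurent (pow_mem q_mem_poly _))
    (fun n k => q_pow_mul_kernel_mul_kernel n m k)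

lemma ChainIntegral.nil_q_pow {f : ℕ → QField} (hf : ChainIntegral f []) :
    ChainIntegral (fun k => q ^ (k * k + k) * f k) [] := by
  intro n
  rw [chainSum, chainSum_transform f (fun k => q ^ (k * k + k)) _ (kernel n) n []
    (q_pow_mul_kernel n), Finset.mul_sum]
  refine sum_mem fun s hs => ?_
  have hsn : s ≤ n := Nat.lt_succ_iff.mp (Finset.mem_range.mp hs)
  -- One copy of [n]! absorbs 1/[n-s]!; the other must supply the second [s]!.
  have h1 : qFac n = gauss n s * qFac (n - s) * qFac s := by
    have := qFac_ne_zero s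
    have := qFac_ne_zero (n - s)
    rw [gauss_eq hsn]
    field_simp
  have h2 : qFac n * chainFac n [] * (q ^ (s * s + s) * ((1 - q) ^ (n - s) * invFacSub n s) *
      chainSum f s []) = gauss n s * gauss n s * qFac (n - s) *
        (q ^ (s * s + s) * (1 - q) ^ (n - s)) * (qFac s * chainFac s [] * chainSum f s []) := by
    have h3 := qFac_mul_invFacSub hsn
    simp only [chainFac]
    linear_combination qFac n * (q ^ (s * s + s) * (1 - q) ^ (n - s)) * chainSum f s [] * h3 +
      (q ^ (s * s + s) * (1 - q) ^ (n - s)) * chainSum f s [] * gauss n s * qFac s * h1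
  rw [h2]
  exact mul_mem (mul_mem (mul_mem (mul_mem (gauss_mem _ _) (gauss_mem _ _)) (qFac_mem _))
    (mul_mem (poly_le_laurent (pow_mem q_mem_poly _)) (pow_mem one_sub_q_mem _))) (hf s)

lemma ChainIntegral.q_pow_mul {f : ℕ → QField} (hf : ChainIntegral f []) (L : List ℕ) {j : ℕ}
    (hj : j ≤ L.length + 1) : ChainIntegral (fun k => (q ^ (k * k + k)) ^ j * f k) L := by
  induction L generalizing j with
  | nil =>
    rcases Nat.le_one_iff_eq_zero_or_eq_one.mp hj with rfl | rfl
    · simpa using hf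
    · simpa using hf.nil_q_pow
  | cons m L ih =>
    cases j with
    | zero => exact (ih (Nat.zero_le _)).cons m
    | succ j =>
      have := (ih (Nat.le_of_succ_le_succ hj)).cons_q_pow m
      simpa only [pow_succ', mul_assoc] using this

/-! ### The weights -/

/-- The quotient `[n - k] [n + k + 1]` of the kernels for `n - 1` and `n`. -/
def kernelRatio (n k : ℕ) : QField :=
  (1 - q ^ ((n : ℤ) - k)) * (1 - q ^ (n + k + 1)) / (1 - q) ^ 2

lemma kernel_zero_mul_kernelRatio (k : ℕ) : kernel 0 k * kernelRatio 0 k = 0 := by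
  cases k with
  | zero => simp [kernelRatio]
  | succ k => rw [kernel_of_lt (Nat.succ_pos k), zero_mul]

lemma kernel_succ_mul_kernelRatio (n k : ℕ) :
    kernel (n + 1) k * kernelRatio (n + 1) k = kernel n k := by
  rcases lt_trichotomy k (n + 1) with h | rfl | h
  · obtain ⟨a, rfl⟩ := Nat.exists_eq_add_of_le (Nat.lt_succ_iff.mp h)
    rw [add_assoc k a 1, kernel_add, kernel_add, kernelRatio,
      show ((k + (a + 1) : ℕ) : ℤ) - k = ((a + 1 : ℕ) : ℤ) by push_cast; ring, zpow_natCast,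
      show a + 1 + (2 * k + 1) = a + (2 * k + 1) + 1 by ring, qFac_succ, qFac_succ,
      show k + (a + 1) + k + 1 = a + (2 * k + 1) + 1 by ring]
    have h1 := qFac_ne_zero a
    have h2 := qFac_ne_zero (a + (2 * k + 1))
    have h3 := qInt_ne_zero (Nat.succ_ne_zero a)
    have h4 := qInt_ne_zero (Nat.succ_ne_zero (a + (2 * k + 1)))
    have h5 : (1 - q ^ (a + 1)) * (1 - q ^ (a + (2 * k + 1) + 1)) / (1 - q) ^ 2 =
        qInt (a + 1) * qInt (a + (2 * k + 1) + 1) := by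
      rw [qInt_eq, qInt_eq, div_mul_div_comm, sq]
    rw [h5]
    field_simp
  · rw [kernel_of_lt (Nat.lt_succ_self n), kernelRatio]
    simp
  · rw [kernel_of_lt h, kernel_of_lt (by lia), zero_mul]

lemma kernelRatio_succ (n k : ℕ) :
    kernelRatio (n + 1) k = q * kernelRatio n k + qInt (2 * n + 2) := by
  have hq := q_ne_zero
  have h1 := one_sub_q_ne_zero
  rw [kernelRatio, kernelRatio, qInt_eq, Nat.cast_succ, zpow_sub₀ hq, zpow_sub₀ hq,
    zpow_add_one₀ hq]
  simp only [zpow_natCast]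
  field_simp
  ring

/-- The square of `q ^ (-k) [2k + 1]`. -/
def sqWeight (k : ℕ) : QField := q ^ (-2 * (k : ℤ)) * qInt (2 * k + 1) ^ 2

/-- Put x = q^(-k) + q^(k+1). Then (1-q)² `sqWeight k` is x² - 4q, while `kernelRatio n k` is affine
in x, so the former is a quadratic in the latter. -/
lemma sqWeight_eq (n k : ℕ) :
    sqWeight k = sqWeight n - 2 * (q + q ^ (-2 * (n : ℤ))) * kernelRatio n k +
      q ^ (-2 * (n : ℤ)) * (1 - q) ^ 2 * kernelRatio n k ^ 2 := by
  have hq := q_ne_zero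
  have h1 := one_sub_q_ne_zero
  rw [sqWeight, sqWeight, kernelRatio, qInt_eq, qInt_eq, zpow_sub₀ hq, neg_mul, neg_mul, zpow_neg,
    zpow_neg, zpow_mul, zpow_mul]
  simp only [zpow_natCast, zpow_ofNat]
  field_simp
  ring

lemma chainSum_congr {f g : ℕ → QField} {n : ℕ} {L : List ℕ}
    (h : ∀ k ≤ n, f k = g k) : chainSum f n L = chainSum g n L :=
  Finset.sum_congr rfl fun k hk => by rw [h k (Nat.lt_succ_iff.mp (Finset.mem_range.mp hk))]

lemma sqWeight_mem (n : ℕ) : sqWeight n ∈ laurentSubring :=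
  mul_mem (q_zpow_mem _) (pow_mem (qInt_mem _) _)

/-- Each factor `kernelRatio` lowers the kernel index by one, once `kernelRatio_succ` has adjusted
the second factor to the lowered index. -/
lemma sqWeight_mul_kernel_add_two (n k : ℕ) :
    sqWeight k * kernel (n + 2) k = sqWeight (n + 2) * kernel (n + 2) k +
      (q ^ (-2 * ((n + 2 : ℕ) : ℤ)) * (1 - q) ^ 2 * qInt (2 * n + 4) -
        2 * (q + q ^ (-2 * ((n + 2 : ℕ) : ℤ)))) * kernel (n + 1) k +
      q ^ (-2 * ((n + 2 : ℕ) : ℤ)) * (1 - q) ^ 2 * q * kernel n k := by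
  rw [← kernel_succ_mul_kernelRatio n k, ← kernel_succ_mul_kernelRatio (n + 1) k,
    sqWeight_eq (n + 2) k]
  have h := kernelRatio_succ (n + 1) k
  rw [show 2 * (n + 1) + 2 = 2 * n + 4 by ring] at h
  linear_combination q ^ (-2 * ((n + 2 : ℕ) : ℤ)) * (1 - q) ^ 2 * kernel (n + 2) k *
    kernelRatio (n + 2) k * h

lemma sqWeight_mul_kernel_one (k : ℕ) :
    sqWeight k * kernel 1 k = sqWeight 1 * kernel 1 k +
      (q ^ (-2 : ℤ) * (1 - q) ^ 2 * qInt 2 - 2 * (q + q ^ (-2 : ℤ))) * kernel 0 k := by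
  have h := kernelRatio_succ 0 k
  -- Here the third term, of index -1, is absent.
  have h0 := kernel_zero_mul_kernelRatio k
  have h1 := kernel_succ_mul_kernelRatio 0 k
  have h2 := sqWeight_eq 1 k
  simp only [zero_add, mul_zero, Nat.cast_one, mul_one] at h h1 h2
  rw [← h1] at h0 ⊢
  rw [h2]
  linear_combination q ^ (-2 : ℤ) * (1 - q) ^ 2 * kernel 1 k * kernelRatio 1 k * h +
    q ^ (-2 : ℤ) * (1 - q) ^ 2 * q * h0

lemma chainSum_nil_extend (f : ℕ → QField) {n s : ℕ} (h : s ≤ n) :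
    chainSum f s [] = ∑ k ∈ Finset.range (n + 1), f k * kernel s k := by
  simpa using chainSum_extend f h []

lemma chainIntegral_nil_iff {f : ℕ → QField} :
    ChainIntegral f [] ↔ ∀ n, qFac n * qFac n * chainSum f n [] ∈ laurentSubring := Iff.rfl

lemma ChainIntegral.sqWeight_mul {f : ℕ → QField} (hf : ChainIntegral f []) :
    ChainIntegral (fun k => sqWeight k * f k) [] := by
  rw [chainIntegral_nil_iff] at hf ⊢
  have htwo : (2 : QField) ∈ laurentSubring := ofNat_mem _ 2
  have hq := poly_le_laurent q_mem_poly
  intro n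
  match n with
  | 0 =>
    rw [chainSum_congr (g := f)]
    · exact hf 0
    · intro k hk
      rw [Nat.le_zero.mp hk]
      simp [sqWeight, qInt_one]
  | 1 =>
    have h1 : chainSum (fun k => sqWeight k * f k) 1 [] = sqWeight 1 * chainSum f 1 [] +
        (q ^ (-2 : ℤ) * (1 - q) ^ 2 * qInt 2 - 2 * (q + q ^ (-2 : ℤ))) * chainSum f 0 [] := by
      rw [chainSum_nil_extend _ le_rfl, chainSum_nil_extend f le_rfl,
        chainSum_nil_extend f zero_le_one, Finset.mul_sum, Finset.mul_sum,
        ← Finset.sum_add_distrib]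
      exact Finset.sum_congr rfl fun k _ => by
        linear_combination f k * sqWeight_mul_kernel_one k
    have h2 : qFac 1 = qFac 0 := by rw [qFac_succ, zero_add, qInt_one, mul_one]
    rw [h1, mul_add]
    refine add_mem ?_ ?_
    · rw [mul_left_comm]
      exact mul_mem (sqWeight_mem _) (hf 1)
    · rw [mul_left_comm, h2]
      exact mul_mem (sub_mem (mul_mem (mul_mem (q_zpow_mem _) (pow_mem one_sub_q_mem _))
        (qInt_mem _)) (mul_mem htwo (add_mem hq (q_zpow_mem _)))) (hf 0)
  | n + 2 =>
    have h1 : chainSum (fun k => sqWeight k * f k) (n + 2) [] =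
        sqWeight (n + 2) * chainSum f (n + 2) [] +
        (q ^ (-2 * ((n + 2 : ℕ) : ℤ)) * (1 - q) ^ 2 * qInt (2 * n + 4) -
          2 * (q + q ^ (-2 * ((n + 2 : ℕ) : ℤ)))) * chainSum f (n + 1) [] +
        q ^ (-2 * ((n + 2 : ℕ) : ℤ)) * (1 - q) ^ 2 * q * chainSum f n [] := by
      rw [chainSum_nil_extend _ le_rfl, chainSum_nil_extend f le_rfl,
        chainSum_nil_extend f (show n + 1 ≤ n + 2 by lia),
        chainSum_nil_extend f (show n ≤ n + 2 by lia), Finset.mul_sum, Finset.mul_sum,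
        Finset.mul_sum, ← Finset.sum_add_distrib, ← Finset.sum_add_distrib]
      exact Finset.sum_congr rfl fun k _ => by
        linear_combination f k * sqWeight_mul_kernel_add_two n k
    have h2 : qFac (n + 2) = qFac n * qInt (n + 1) * qInt (n + 2) := by
      rw [qFac_succ, qFac_succ]
    have h3 : ∀ A B C : QField, qFac (n + 2) * qFac (n + 2) * (A * chainSum f (n + 2) [] +
        B * chainSum f (n + 1) [] + C * chainSum f n []) =
        A * (qFac (n + 2) * qFac (n + 2) * chainSum f (n + 2) []) +
        B * qInt (n + 2) ^ 2 * (qFac (n + 1) * qFac (n + 1) * chainSum f (n + 1) []) +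
        C * (qInt (n + 1) * qInt (n + 2)) ^ 2 * (qFac n * qFac n * chainSum f n []) := by
      intro A B C
      rw [h2, qFac_succ n]
      ring
    have hz := q_zpow_mem (-2 * ((n + 2 : ℕ) : ℤ))
    have hs := pow_mem one_sub_q_mem 2
    rw [h1, h3]
    refine add_mem (add_mem ?_ ?_) ?_
    · exact mul_mem (sqWeight_mem _) (hf _)
    · exact mul_mem (mul_mem (sub_mem (mul_mem (mul_mem hz hs) (qInt_mem _))
        (mul_mem htwo (add_mem hq hz))) (pow_mem (qInt_mem _) _)) (hf _)
    · exact mul_mem (mul_mem (mul_mem (mul_mem hz hs) hq)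
        (pow_mem (mul_mem (qInt_mem _) (qInt_mem _)) _)) (hf _)

lemma ChainIntegral.sqWeight_pow_mul {f : ℕ → QField} (hf : ChainIntegral f []) (r : ℕ) :
    ChainIntegral (fun k => sqWeight k ^ r * f k) [] := by
  induction r with
  | zero => simpa using hf
  | succ r ih => simpa only [pow_succ', mul_assoc] using ih.sqWeight_mul

/-! ### Base weights: closed forms of sums against one kernel -/

lemma kernel_self (n : ℕ) : kernel n n = (qFac (2 * n) * qInt (2 * n + 1))⁻¹ := by
  rw [kernel, if_pos le_rfl, Nat.sub_self, qFac_zero, one_mul, ← two_mul, qFac_succ]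

/-- Telescoping: each term is q^(-n) times the difference of 1/([n-k]! [n+k]!) at k and k + 1. The
bound m ≤ n leaves out k = n, where 1/[-1]! would be needed. -/
lemma sum_range_plain {n m : ℕ} (h : m ≤ n) :
    ∑ k ∈ Finset.range m, q ^ (-(k : ℤ)) * qInt (2 * k + 1) * kernel n k =
      q ^ (-(n : ℤ)) * ((qFac n * qFac n)⁻¹ - (qFac (n - m) * qFac (n + m))⁻¹) := by
  induction m with
  | zero => simp
  | succ m ih =>
    obtain ⟨a, rfl⟩ := Nat.exists_eq_add_of_lt (show m < n by lia)
    rw [Finset.sum_range_succ, ih (by lia), kernel, if_pos (by lia),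
      show m + a + 1 - m = a + 1 by lia, show m + a + 1 - (m + 1) = a by lia,
      ← add_assoc (m + a + 1) m 1,
      qFac_succ a, qFac_succ (m + a + 1 + m)]
    have h1 := qFac_ne_zero a
    have h2 := qFac_ne_zero (m + a + 1 + m)
    have h3 := qInt_ne_zero (Nat.succ_ne_zero a)
    have h4 := qInt_ne_zero (Nat.succ_ne_zero (m + a + 1 + m))
    have h5 : qInt (m + a + 1 + m + 1) = qInt (a + 1) + q ^ (a + 1) * qInt (2 * m + 1) := by
      rw [← qInt_add]
      congr 1
      ring
    have h6 : q ^ (-(m : ℤ)) = q ^ (-((m + a + 1 : ℕ) : ℤ)) * q ^ (a + 1) := by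
      rw [← zpow_natCast q (a + 1), ← zpow_add₀ q_ne_zero]
      congr 1
      push_cast
      ring
    have h7 : (qFac (a + 1) * qFac (m + a + 1 + m))⁻¹ =
        qInt (m + a + 1 + m + 1) * (qFac (a + 1) * qFac (m + a + 1 + m + 1))⁻¹ := by
      rw [qFac_succ (m + a + 1 + m)]
      field_simp
    have h8 : (qFac a * qFac (m + a + 1 + m + 1))⁻¹ =
        qInt (a + 1) * (qFac (a + 1) * qFac (m + a + 1 + m + 1))⁻¹ := by
      rw [qFac_succ a]
      field_simp
    rw [← qFac_succ, ← qFac_succ, h7, h8, h5, h6]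
    ring

lemma chainIntegral_plain :
    ChainIntegral (fun k => q ^ (-(k : ℤ)) * qInt (2 * k + 1)) [] := by
  rw [chainIntegral_nil_iff]
  intro n
  have h : chainSum (fun k => q ^ (-(k : ℤ)) * qInt (2 * k + 1)) n [] =
      q ^ (-(n : ℤ)) * (qFac n * qFac n)⁻¹ := by
    rw [chainSum_nil_extend _ le_rfl, Finset.sum_range_succ, sum_range_plain le_rfl, kernel_self,
      Nat.sub_self, qFac_zero, ← two_mul]
    have := qInt_ne_zero (Nat.succ_ne_zero (2 * n))
    have := qFac_ne_zero n
    have := qFac_ne_zero (2 * n)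
    field_simp
    ring
  rw [h, mul_left_comm, mul_inv_cancel₀ (mul_ne_zero (qFac_ne_zero n) (qFac_ne_zero n)), mul_one]
  exact q_zpow_mem _

/-- Telescoping again, resting on [n][2m+1] - [m][n+m+1] = q^m [m+1][n-m]. At m = n the result
cancels the last term, so the full sum vanishes for n > 0. -/
lemma sum_range_alt {n m : ℕ} (h : m ≤ n) :
    qInt n * ∑ k ∈ Finset.range m, (-1) ^ k * q ^ k.choose 2 * qInt (2 * k + 1) * kernel n k =
      -((-1) ^ m * q ^ m.choose 2 * qInt m * (qFac (n - m) * qFac (n + m))⁻¹) := by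
  induction m with
  | zero => simp [qInt]
  | succ m ih =>
    obtain ⟨a, rfl⟩ := Nat.exists_eq_add_of_lt (show m < n by lia)
    rw [Finset.sum_range_succ, mul_add, ih (by lia), kernel, if_pos (by lia),
      show m + a + 1 - m = a + 1 by lia, show m + a + 1 - (m + 1) = a by lia,
      ← add_assoc (m + a + 1) m 1]
    have h1 := qFac_ne_zero a
    have h2 := qFac_ne_zero (m + a + 1 + m)
    have h3 := qInt_ne_zero (Nat.succ_ne_zero a)
    have h4 := qInt_ne_zero (Nat.succ_ne_zero (m + a + 1 + m))
    have h7 : (qFac (a + 1) * qFac (m + a + 1 + m))⁻¹ =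
        qInt (m + a + 1 + m + 1) * (qFac (a + 1) * qFac (m + a + 1 + m + 1))⁻¹ := by
      rw [qFac_succ (m + a + 1 + m)]
      field_simp
    have h8 : (qFac a * qFac (m + a + 1 + m + 1))⁻¹ =
        qInt (a + 1) * (qFac (a + 1) * qFac (m + a + 1 + m + 1))⁻¹ := by
      rw [qFac_succ a]
      field_simp
    have h9 : qInt (m + a + 1) * qInt (2 * m + 1) - qInt m * qInt (m + a + 1 + m + 1) =
        q ^ m * qInt (m + 1) * qInt (a + 1) := by
      simp only [qInt_eq]
      have := one_sub_q_ne_zero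
      field_simp
      ring
    rw [h7, h8, Nat.choose_succ_succ' m 1, Nat.choose_one_right]
    linear_combination (-1) ^ m * q ^ m.choose 2 *
      (qFac (a + 1) * qFac (m + a + 1 + m + 1))⁻¹ * h9

lemma chainIntegral_alt :
    ChainIntegral (fun k => (-1) ^ k * q ^ k.choose 2 * qInt (2 * k + 1)) [] := by
  rw [chainIntegral_nil_iff]
  intro n
  rcases Nat.eq_zero_or_pos n with rfl | hn
  · rw [chainSum_nil_extend _ le_rfl]
    simp [qInt_one, kernel, qFac_zero, qFac_succ, one_mem]
  · have h : chainSum (fun k => (-1) ^ k * q ^ k.choose 2 * qInt (2 * k + 1)) n [] = 0 := by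
      have h0 := qInt_ne_zero hn.ne'
      rw [← mul_right_inj' h0, chainSum_nil_extend _ le_rfl, Finset.sum_range_succ, mul_add,
        sum_range_alt le_rfl, kernel_self, Nat.sub_self, qFac_zero, ← two_mul]
      have := qInt_ne_zero (Nat.succ_ne_zero (2 * n))
      have := qFac_ne_zero (2 * n)
      field_simp
      ring
    rw [h, mul_zero]
    exact zero_mem _

/-! ### The triple sum -/

lemma exists_base_weight (j r : ℕ) {ε : ℕ → QField} (hε : ε = epsPlain j r ∨ ε = epsAlt j r) :
    ∃ f, ChainIntegral f [] ∧
      ∀ k, ε k * qInt (2 * k + 1) ^ (2 * r + 1) = (q ^ (k * k + k)) ^ j * f k := by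
  have hq := q_ne_zero
  have hsq : ∀ k, sqWeight k ^ r = q ^ (-2 * (r : ℤ) * k) * qInt (2 * k + 1) ^ (2 * r) := by
    intro k
    rw [sqWeight, mul_pow, ← pow_mul, ← zpow_natCast, ← zpow_mul]
    congr 2
    ring
  have hj : ∀ k : ℕ, (q ^ (k * k + k)) ^ j = q ^ ((j : ℤ) * ((k : ℤ) ^ 2 + k)) := by
    intro k
    rw [← pow_mul, ← zpow_natCast]
    congr 1
    push_cast
    ring
  rcases hε with rfl | rfl
  · refine ⟨_, chainIntegral_plain.sqWeight_pow_mul r, fun k => ?_⟩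
    rw [hsq, hj, epsPlain, show (j : ℤ) * ((k : ℤ) ^ 2 + k) - (2 * (r : ℤ) + 1) * k =
      (j : ℤ) * ((k : ℤ) ^ 2 + k) + (-2 * (r : ℤ) * k) + -(k : ℤ) by ring, zpow_add₀ hq,
      zpow_add₀ hq]
    ring
  · refine ⟨_, chainIntegral_alt.sqWeight_pow_mul r, fun k => ?_⟩
    rw [hsq, hj, epsAlt, show (k.choose 2 : ℤ) + (j : ℤ) * ((k : ℤ) ^ 2 + k) - 2 * (r : ℤ) * k =
      (j : ℤ) * ((k : ℤ) ^ 2 + k) + (-2 * (r : ℤ) * k) + (k.choose 2 : ℤ) by ring, zpow_add₀ hq,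
      zpow_add₀ hq, zpow_natCast]
    ring

/-- Repeating an entry costs [2n+1]!, exactly the prefactor turning its kernel into a q-binomial;
only changes of entry and the two ends affect the modulus. -/
lemma chainFac_replicate (n : ℕ) (d : ℕ) (L : List ℕ) :
    chainFac n (List.replicate d n ++ L) = qFac (2 * n + 1) ^ d * chainFac n L := by
  induction d with
  | zero => simp
  | succ d ih =>
    rw [List.replicate_succ, List.cons_append, chainFac, ih, ← two_mul]
    ring

lemma qBinom_eq_kernel {n k : ℕ} (h : k ≤ n) :
    qBinom ((2 * n + 1 : ℕ) : ℤ) ((n : ℤ) - k) = qFac (2 * n + 1) * kernel n k := by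
  rw [← Nat.cast_sub h, qBinom_natCast (by lia), gauss_eq (by lia), kernel, if_pos h,
    show 2 * n + 1 - (n - k) = n + k + 1 by lia, div_eq_mul_inv]

/-- For a chain made of blocks of three values `x`, `y`, `z`, the sum of the products of kernels
multiplied by the chain of factorials. -/
lemma chainSum_blocks_mem {f : ℕ → QField} (hf : ChainIntegral f []) (x y z : ℕ) {a b c j : ℕ}
    (hj : j ≤ (a + 1) + (b + 1) + (c + 1)) :
    qFac x * qFac z * qFac (x + y + 1) * qFac (y + z + 1) * (qFac (2 * x + 1) ^ a *
      qFac (2 * y + 1) ^ b * qFac (2 * z + 1) ^ c) *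
      ∑ k ∈ Finset.range (x + 1), (q ^ (k * k + k)) ^ j * f k *
        (kernel x k ^ (a + 1) * kernel y k ^ (b + 1) * kernel z k ^ (c + 1)) ∈
      laurentSubring := by
  have h := hf.q_pow_mul (List.replicate a x ++ y :: (List.replicate b y ++ z ::
    (List.replicate c z ++ []))) (j := j)
    (by simp only [List.length_append, List.length_cons, List.length_replicate, List.length_nil]
        lia) x
  rw [chainFac_replicate, chainFac, chainFac_replicate, chainFac, chainFac_replicate,
    chainFac] at h
  convert h using 1
  have h1 : ∀ S, qFac x * (qFac (2 * x + 1) ^ a * (qFac (x + y + 1) * (qFac (2 * y + 1) ^ b *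
      (qFac (y + z + 1) * (qFac (2 * z + 1) ^ c * qFac z))))) * S =
      qFac x * qFac z * qFac (x + y + 1) * qFac (y + z + 1) * (qFac (2 * x + 1) ^ a *
      qFac (2 * y + 1) ^ b * qFac (2 * z + 1) ^ c) * S := fun S => by ring
  rw [h1, chainSum]
  congr 1
  refine Finset.sum_congr rfl fun k _ => ?_
  simp only [List.map_append, List.map_cons, List.map_replicate, List.prod_append, List.prod_cons,
    List.prod_replicate, List.map_nil, List.prod_nil]
  ring

lemma laurentModEq_zero {D S x : QField} (hD : D ∈ polySubring) (hx : x ∈ laurentSubring)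
    (h : S = D * x) : LaurentModEq D S 0 := by
  obtain ⟨d, rfl⟩ := hD
  obtain ⟨y, rfl⟩ := hx
  refine ⟨d, Polynomial.toLaurent d * y, 0, rfl, ?_, map_zero _, ?_⟩
  · rw [h, map_mul]
    rfl
  · rw [sub_zero]
    exact dvd_mul_right _ _

lemma tripleSum_eq {ε f : ℕ → QField} {r j : ℕ} (n a b c : ℕ)
    (h : ∀ k, ε k * qInt (2 * k + 1) ^ (2 * r + 1) = (q ^ (k * k + k)) ^ j * f k) :
    tripleSum ε n a b c r = qFac (6 * n + 1) ^ a * qFac (4 * n + 1) ^ b * qFac (2 * n + 1) ^ c *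
      ∑ k ∈ Finset.range (n + 1), (q ^ (k * k + k)) ^ j * f k *
        (kernel (3 * n) k ^ a * kernel (2 * n) k ^ b * kernel n k ^ c) := by
  rw [tripleSum, Finset.mul_sum]
  refine Finset.sum_congr rfl fun k hk => ?_
  have hkn : k ≤ n := Nat.lt_succ_iff.mp (Finset.mem_range.mp hk)
  have h3 := qBinom_eq_kernel (show k ≤ 3 * n by lia)
  have h2 := qBinom_eq_kernel (show k ≤ 2 * n by lia)
  have h1 := qBinom_eq_kernel hkn
  rw [show 2 * (3 * n) + 1 = 6 * n + 1 by ring] at h3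
  rw [show 2 * (2 * n) + 1 = 4 * n + 1 by ring] at h2
  push_cast at h1 h2 h3
  rw [h, h1, h2, h3]
  ring

end QCong

end

theorem corollary7p5 (a b c n j r : ℕ) (ha : 1 ≤ a) (hb : 1 ≤ b) (hc : 1 ≤ c) (hn : 1 ≤ n)
    (hj : j ≤ a + b + c) (ε : ℕ → QCong.QField)
    (hε : ε = QCong.epsPlain j r ∨ ε = QCong.epsAlt j r) :
    QCong.LaurentModEq (QCong.qInt (2 * n + 1) * QCong.qBinom (6 * n + 1) n)
        (QCong.tripleSum ε n a b c r) 0 ∧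
      QCong.LaurentModEq (QCong.qInt (2 * n + 1) * QCong.qBinom (6 * n + 1) (3 * n))
        (QCong.tripleSum ε n a b c r) 0 := by
  obtain ⟨f, hf, hfe⟩ := QCong.exists_base_weight j r hε
  obtain ⟨a, rfl⟩ := Nat.exists_eq_add_of_le' ha
  obtain ⟨b, rfl⟩ := Nat.exists_eq_add_of_le' hb
  obtain ⟨c, rfl⟩ := Nat.exists_eq_add_of_le' hc
  rw [QCong.tripleSum_eq n _ _ _ hfe]
  have hB1 : QCong.qBinom (6 * n + 1) n = QCong.gauss (6 * n + 1) n := by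
    exact_mod_cast QCong.qBinom_natCast (show n ≤ 6 * n + 1 by lia)
  have hB3 : QCong.qBinom (6 * n + 1) (3 * n) = QCong.gauss (6 * n + 1) (3 * n) := by
    exact_mod_cast QCong.qBinom_natCast (show 3 * n ≤ 6 * n + 1 by lia)
  have e6 : 2 * (3 * n) + 1 = 6 * n + 1 := by ring
  have e4 : 2 * (2 * n) + 1 = 4 * n + 1 := by ring
  have n1 := QCong.qFac_ne_zero n
  have n2 := QCong.qFac_ne_zero (2 * n)
  have n3 := QCong.qFac_ne_zero (3 * n)
  have n31 := QCong.qFac_ne_zero (3 * n + 1)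
  have n51 := QCong.qFac_ne_zero (5 * n + 1)
  rw [hB1, hB3, QCong.qFac_succ (2 * n)]
  constructor
  -- Order (n, 3n, 2n): the leftover [6n+1]! [4n+1]! [2n+1]! over [n]! [2n]! [4n+1]! [5n+1]! is the
  -- first modulus.
  · refine QCong.laurentModEq_zero
      (mul_mem (QCong.qInt_mem_poly _) (QCong.gauss_mem_poly _ _))
      (QCong.chainSum_blocks_mem hf n (3 * n) (2 * n) (a := c) (b := a) (c := b) (j := j)
        (by lia)) ?_
    rw [e6, e4, show n + 3 * n + 1 = 4 * n + 1 by ring, show 3 * n + 2 * n + 1 = 5 * n + 1 by ring,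
      QCong.gauss_eq (show n ≤ 6 * n + 1 by lia), show 6 * n + 1 - n = 5 * n + 1 by lia,
      QCong.qFac_succ (2 * n)]
    have hS : ∀ k, QCong.kernel n k ^ (c + 1) * QCong.kernel (3 * n) k ^ (a + 1) *
        QCong.kernel (2 * n) k ^ (b + 1) = QCong.kernel (3 * n) k ^ (a + 1) *
        QCong.kernel (2 * n) k ^ (b + 1) * QCong.kernel n k ^ (c + 1) := fun k => by ring
    simp only [hS]
    field_simp
    ring
  · have hext : ∑ k ∈ Finset.range (3 * n + 1), (QCong.q ^ (k * k + k)) ^ j * f k *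
        (QCong.kernel (3 * n) k ^ (a + 1) * QCong.kernel n k ^ (c + 1) *
          QCong.kernel (2 * n) k ^ (b + 1)) =
        ∑ k ∈ Finset.range (n + 1), (QCong.q ^ (k * k + k)) ^ j * f k *
        (QCong.kernel (3 * n) k ^ (a + 1) * QCong.kernel (2 * n) k ^ (b + 1) *
          QCong.kernel n k ^ (c + 1)) := by
      symm
      refine (Finset.sum_congr rfl fun k _ => ?_).trans
        (Finset.sum_subset (Finset.range_mono (by lia)) fun k _ hk => ?_)
      · ring
      · rw [QCong.kernel_of_lt (show n < k by simpa using hk)]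
        ring
    -- Order (3n, n, 2n): the denominator becomes [3n]! [2n]! [4n+1]! [3n+1]!. The sum now runs to
    -- 3n, harmlessly by `hext`.
    refine QCong.laurentModEq_zero
      (mul_mem (QCong.qInt_mem_poly _) (QCong.gauss_mem_poly _ _))
      (QCong.chainSum_blocks_mem hf (3 * n) n (2 * n) (a := a) (b := c) (c := b) (j := j)
        (by lia)) ?_
    rw [hext, e6, e4, show 3 * n + n + 1 = 4 * n + 1 by ring,
      show n + 2 * n + 1 = 3 * n + 1 by ring, QCong.gauss_eq (show 3 * n ≤ 6 * n + 1 by lia),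
      show 6 * n + 1 - 3 * n = 3 * n + 1 by lia, QCong.qFac_succ (2 * n)]
    field_simp
    ring
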